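/- **Setting.** Let $H$ be a complex separable Hilbert space, $D\subseteq H$ a dense subspace and $(A_{t]})_{t\ge 0}$ an increasing family of von Neumann algebras on $H$ with commutants $A_{t]}'$. Random variables are operators on $D$ with an adjoint defined on $D$; a random variable $F$ is $t$-adapted if $F$ and $F^*$ extend to the span $D_t'$ of $A_{t]}'D$ as mutually adjoint operators with $F\alpha'\xi=\alpha' F\xi$, $F^*\alpha'\xi=\alpha' F^*\xi$ ($\alpha'\in A_{t]}'$, $\xi\in D$). Let $W$ be the $*$-algebra of processes: families $(F_t)_{t\ge0}$ of random variables leaving $D$ invariant, together with their adjoints, with $t\mapsto F_t\eta$ Borel measurable for each $\eta\in D$. A process is adapted if each $F_t$ is $t$-adapted. A regular additive adapted process $M(s,t)$ is an integrator of scalar type if there are finite sets $J(\xi)\subseteq D$ (with $J(\eta)\subseteq J(\xi)$ for $\eta\in J(\xi)$), constants $c_{t,\xi}\geq 0$ and positive, locally finite, non-atomic measures $\mu_\xi$, absolutely continuous with respect to Lebesgue measure, such that for all simple adapted processes $F$ $$\Big\|\int_0^t dM_s F_s\,\xi\Big\|^2\le c_{t,\xi}\int_0^t \sum_{\eta\in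 J(\xi)}\|F_s\eta\|^2\,d\mu_\xi(s),\qquad \Big\|\int_0^t F_s^*\,dM_s^*\,\xi\Big\|^2\le c_{t,\xi}\int_0^t \sum_{\eta\in J(\xi)}\|F_s^*\eta\|^2\,d\mu_\xi(s).$$ The integral $\int_0^t dM_sF_s$ is extended by continuity to adapted processes $F$ with $\int_0^t(\|F_s\eta\|^2+\|F_s^*\eta\|^2)\,d\mu_\xi(s)<\infty$ for all $\xi\in D$, $\eta\in J(\xi)$; such $F$, taken over all $t\ge 0$ (respectively over $t\leq T$), are called integrable with respect to $M$ (respectively on $[0,T]$). Let $I$ be a finite set, and $M_0$, $M_a$ ($a\in I$) integrators of scalar type, where $dM_0=d\tau$ for a real-valued measure $\tau$ on $[0,\infty)$ absolutely continuous with respect to Lebesgue measure. The family $(M_a)_{a\in I}$ is self-adjoint, $(M_a)^*=M_{a^*}$, and $j:I\to I$ is defined by $j(a^*)=a$. For each $a\in I$, $\rho_a$ is an automorphism of the algebra $W$ with $\rho_a^2=\mathrm{id}$ that maps adapted processes to adapted processes and satisfies, for adapted $F\in W$, $s<t$ and $\xi\in D$, $M_a(s,t)F_s\xi=\rho_a(F)_sM_a(s,t)\xi$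 and $F_sM_a(s,t)\xi=M_a(s,t)\rho_a(F)_s\xi$. The structure processes $c_0(a,b),c_\varepsilon(a,b)\in W$ are adapted, integrable, and given by the Itô table $$dM_a\,dM_b=d\tau\,c_0(a,b)+\sum_{\varepsilon\in I}dM_\varepsilon\,c_\varepsilon(a,b),\qquad dM_a\,d\tau=d\tau\,dM_a=0,$$ in the sense of Meyer brackets (norm limits on $D$ of sums of products of increments over partitions). The family $\{M_0,M_a\}$ is linearly independent: if $G,G_a\in W$ are integrable adapted processes with $\int_0^t d\tau\,G+\sum_a\int_0^t dM_a\,G_a=0$ on $D$ for all $t\ge0$, then $G=G_a=0$ for all $a\in I$ (processes being identified when they agree at almost every time). A process $X$ has the differential $dX=d\tau\,X_0+\sum_a dM_a\,X_a$ on $[0,T]$ if the $X_0,X_a\in W$ are integrable on $[0,T]$ and $X(t)=X(0)+\int_0^t(d\tau\,X_0+\sum_a dM_a\,X_a)$ on $D$ for $0\le t\le T$. Products of differentials are computed from left to right with the rules $P\,dM_a=dM_a\,\rho_a(P)$, $P\,d\tau=d\tau\,P$ for $P\in W$, with $(dM_aX)^*=dM_{a^*}\rho_{a^*}(X^*)$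 and $(d\tau X)^*=d\tau X^*$, and with the Itô table, all products of differentials containing $d\tau$ being zero. An equation between differentials means that, after collecting coefficients, they are integrable on $[0,T]$ and the corresponding integrals over $[0,t]$ agree on $D$ for $0\le t\le T$. **Data.** Let $0<T<\infty$, let $F,G,L,w,z,F_a$ ($a\in I$) be locally bounded adapted processes in $W$, let $Q,R,m,\eta\in W$ be locally bounded, strongly continuous and adapted, where $R$ has an inverse $R^{-1}\in W$ with the same properties and $Q(t)\ge0$, $R(t)\ge0$, $R^{-1}(t)>0$ on $[0,T]$, and let $Q_T,m_T,Q_0,m_0$ be bounded operators on $H$ with $Q_T\geq 0$, $Q_0\ge0$. In $\pm$ take everywhere the upper sign, with boundary time $T$, or everywhere the lower sign, with boundary time $0$. Put $N_w=\sum_a dM_aF_aw$, $N_z=\sum_a dM_aF_az$. Consider, for self-adjoint, locally bounded, adapted $\Pi\in W$, the Riccati equation on $[0,T]$ $$d\tau\,(F^*\Pi+\Pi F+Q-\Pi GR^{-1}G^*\Pi)+N_w^*\Pi+\Pi N_w\pm N_w^*\Pi N_w\pm(N_w\pm \mathrm{id})^*\,d\Pi\,(N_w\pm \mathrm{id})=0,\tag{R}$$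 with $\Pi(T)=Q_T$ (resp. $\Pi(0)=Q_0$), and, for locally bounded adapted $r\in W$, $$d\tau\,(F^*r-\Pi GR^{-1}G^*r+\Pi L+m^*-\Pi GR^{-1}\eta^*)+N_w^*r+\Pi N_z+d\Pi\,N_z\pm N_w^*\Pi N_z\pm N_w^*\,d\Pi\,N_z+(N_w\pm \mathrm{id})^*dr=0,\tag{r}$$ with $r(T)=m_T^*$ (resp. $r(0)=m_0^*$); solutions are understood to have stochastic differentials. **Claim.** Write $K_a=\rho_a(w^*F_{j(a)}^*)$. (1) $\Pi$ solves (R) if and only if it satisfies the boundary condition and $$d\Pi=d\tau\,A+\sum_{a\in I}dM_a\,B_a\quad\text{on }[0,T]$$ for processes $A,B_a\in W$ such that on $[0,T]$ $$F^*\Pi+\Pi F+Q-\Pi GR^{-1}G^*\Pi\pm A+\sum_{a,b\in I}\Big[\pm c_0(a,b)\rho_b(K_a\Pi)F_bw+c_0(a,b)\rho_b(K_a)B_b+c_0(a,b)\rho_b(B_a)F_bw\pm\sum_{\gamma,\varepsilon\in I}c_0(\varepsilon,\gamma)\rho_\gamma(c_\varepsilon(a,b))\rho_\gamma(\rho_b(K_a)B_b)F_\gamma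 w\Big]=0$$ and, for all $J\in I$, $$K_J\Pi+\rho_J(\Pi)F_Jw\pm B_J+\sum_{a,b\in I}\Big[\pm c_J(a,b)\rho_b(K_a\Pi)F_bw+c_J(a,b)\rho_b(K_a)B_b+c_J(a,b)\rho_b(B_a)F_bw\pm\sum_{\gamma,\varepsilon\in I}c_J(\varepsilon,\gamma)\rho_\gamma(c_\varepsilon(a,b))\rho_\gamma(\rho_b(K_a)B_b)F_\gamma w\Big]=0.$$ Moreover, whenever $d\Pi=d\tau\,A+\sum_adM_aB_a$ on $[0,T]$, the differential equation (R) holds with this differential if and only if these operator equations hold. (2) Let $d\Pi=d\tau\,A+\sum_a dM_a\,B_a$ on $[0,T]$. Then $r$ solves (r) if and only if it satisfies the boundary condition and $$dr=d\tau\,C+\sum_{a\in I}dM_a\,D_a\quad\text{on }[0,T]$$ for processes $C,D_a\in W$ such that on $[0,T]$ $$F^*r-\Pi GR^{-1}G^*r+\Pi L+m^*-\Pi GR^{-1}\eta^*\pm C+\sum_{a,b\in I}\Big[c_0(a,b)\rho_b(B_a)F_bz\pm c_0(a,b)\rho_b(K_a\Pi)F_bz+c_0(a,b)\rho_b(K_a)D_b\pm\sum_{\gamma,\varepsilon\in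 I}c_0(\varepsilon,\gamma)\rho_\gamma(c_\varepsilon(a,b))\rho_\gamma(\rho_b(K_a)B_b)F_\gamma z\Big]=0$$ and, for all $J\in I$, $$K_Jr+\rho_J(\Pi)F_Jz\pm D_J+\sum_{a,b\in I}\Big[c_J(a,b)\rho_b(B_a)F_bz\pm c_J(a,b)\rho_b(K_a\Pi)F_bz+c_J(a,b)\rho_b(K_a)D_b\pm\sum_{\gamma,\varepsilon\in I}c_J(\varepsilon,\gamma)\rho_\gamma(c_\varepsilon(a,b))\rho_\gamma(\rho_b(K_a)B_b)F_\gamma z\Big]=0.$$ Moreover, whenever $dr=d\tau\,C+\sum_adM_aD_a$ on $[0,T]$, the differential equation (r) holds with this differential if and only if these operator equations hold. An operator equation "on $[0,T]$" holds at almost every $t\in[0,T]$, and at every $t\in[0,T]$ if its left-hand side is strongly continuous on $D$ over $[0,T]$. -/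

import Mathlib

open scoped NNReal ENNReal
open MeasureTheory Set

namespace AFQ

/-! ## Framework of the representation free calculus -/

/-- Lebesgue measure on the half-line `[0, ∞)`. -/
noncomputable def lebesgue : Measure ℝ≥0 := Measure.comap ((↑) : ℝ≥0 → ℝ) volume

/-- Dense invariant domain `D` and an increasing family `alg t` of von Neumann algebras. -/
structure Frame (H : Type*) [NormedAddCommGroup H] [InnerProductSpace ℂ H] [CompleteSpace H] where
  D : Submodule ℂ H
  dense_D : Dense (D : Set H)
  alg : ℝ≥0 → VonNeumannAlgebra H
  alg_mono : Monotone alg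

section

variable {H : Type*} [NormedAddCommGroup H] [InnerProductSpace ℂ H] [CompleteSpace H]

/-- Random variables, as operators on `D`: linear maps `D → H` possessing an adjoint on `D`. -/
structure RandomVariable (S : Frame H) where
  op : S.D →ₗ[ℂ] H
  adj : S.D →ₗ[ℂ] H
  inner_adj : ∀ ξ η : S.D, inner ℂ (op ξ) (η : H) = inner ℂ (ξ : H) (adj η)

/-- The adjoint random variable. -/
def RandomVariable.star {S : Frame H} (F : RandomVariable S) : RandomVariable S where
  op := F.adj
  adj := F.op
  inner_adj ξ η := by
    rw [← inner_conj_symm, ← F.inner_adj η ξ, inner_conj_symm]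

/-- `D'_t`, the linear span of `A_t' D`, where `A_t'` is the commutant of `alg t`. -/
def Frame.primeDomain (S : Frame H) (t : ℝ≥0) : Submodule ℂ H :=
  Submodule.span ℂ {x | ∃ α ∈ (S.alg t).commutant, ∃ ξ : S.D, x = α (ξ : H)}

theorem Frame.mem_primeDomain (S : Frame H) (t : ℝ≥0) {α : H →L[ℂ] H}
    (hα : α ∈ (S.alg t).commutant) (ξ : S.D) : α (ξ : H) ∈ S.primeDomain t :=
  Submodule.subset_span ⟨α, hα, ξ, rfl⟩

/-- `F` is `t`-adapted: `F` and its adjoint extend to `D'_t`, are adjoint to each other there,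
and satisfy `F α' ξ = α' F ξ`, `F* α' ξ = α' F* ξ` for `α' ∈ A_t'` and `ξ ∈ D`. -/
def RandomVariable.IsAdaptedAt {S : Frame H} (F : RandomVariable S) (t : ℝ≥0) : Prop :=
  ∃ X Y : S.primeDomain t →ₗ[ℂ] H,
    (∀ x y : S.primeDomain t, inner ℂ (X x) (y : H) = inner ℂ (x : H) (Y y)) ∧
    ∀ (α : H →L[ℂ] H) (hα : α ∈ (S.alg t).commutant) (ξ : S.D),
      X ⟨α ξ, S.mem_primeDomain t hα ξ⟩ = α (F.op ξ) ∧
      Y ⟨α ξ, S.mem_primeDomain t hα ξ⟩ = α (F.adj ξ)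

/-- The graph of the `t`-adapted operator with domain `D'_t` determined by `F`. -/
def RandomVariable.graph {S : Frame H} (F : RandomVariable S) (t : ℝ≥0) : Submodule ℂ (H × H) :=
  Submodule.span ℂ {p | ∃ α ∈ (S.alg t).commutant, ∃ ξ : S.D, p = (α (ξ : H), α (F.op ξ))}

/-- The graph of the closure of the `t`-adapted operator with domain `D'_t` given by `F`. -/
def RandomVariable.closedGraph {S : Frame H} (F : RandomVariable S) (t : ℝ≥0) :
    Submodule ℂ (H × H) :=
  (F.graph t).topologicalClosure

/-- `H_t(ξ)`, the closure of `{α ξ | α ∈ A_t}`. -/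
def Frame.cyclic (S : Frame H) (t : ℝ≥0) (ξ : S.D) : Set H :=
  closure {x | ∃ α ∈ S.alg t, x = α (ξ : H)}

/-! ## Simple processes, integrators and stochastic integrals -/

/-- A simple adapted process `∑ₖ χ_[tₖ, tₖ₊₁) F_{tₖ}`. -/
structure SimpleProcess (S : Frame H) where
  n : ℕ
  time : ℕ → ℝ≥0
  time_mono : Monotone time
  val : Fin n → RandomVariable S
  adapted : ∀ k, (val k).IsAdaptedAt (time k)

/-- Value of a simple process at time `s`, on `η ∈ D`. -/
noncomputable def SimpleProcess.eval {S : Frame H} (F : SimpleProcess S) (s : ℝ≥0) (η : S.D) : H :=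
  ∑ k : Fin F.n, (Ico (F.time k) (F.time (k + 1))).indicator (fun _ => (F.val k).op η) s

/-- Value of the adjoint of a simple process at time `s`, on `η ∈ D`. -/
noncomputable def SimpleProcess.evalAdj {S : Frame H} (F : SimpleProcess S) (s : ℝ≥0) (η : S.D) :
    H :=
  ∑ k : Fin F.n, (Ico (F.time k) (F.time (k + 1))).indicator (fun _ => (F.val k).adj η) s

/-- `v = ∫₀ᵗ dM F ξ = ∑ₖ M̄(tₖ ∧ t, tₖ₊₁ ∧ t) F_{tₖ} ξ` for a simple process `F`. -/
def SimpleProcess.IsLeftIntegral {S : Frame H} (F : SimpleProcess S)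
    (M : ℝ≥0 → ℝ≥0 → RandomVariable S) (t : ℝ≥0) (ξ : S.D) (v : H) : Prop :=
  ∃ y : Fin F.n → H,
    (∀ k : Fin F.n, ((F.val k).op ξ, y k) ∈
      (M (min (F.time k) t) (min (F.time (k + 1)) t)).closedGraph (min (F.time (k + 1)) t)) ∧
    v = ∑ k, y k

/-- `v = ∫₀ᵗ F* dM* ξ = ∑ₖ F_{tₖ}* M*(tₖ ∧ t, tₖ₊₁ ∧ t) ξ` for a simple process `F`. -/
def SimpleProcess.IsRightAdjointIntegral {S : Frame H} (F : SimpleProcess S)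
    (M : ℝ≥0 → ℝ≥0 → RandomVariable S) (t : ℝ≥0) (ξ : S.D) (v : H) : Prop :=
  ∃ y : Fin F.n → H,
    (∀ k : Fin F.n,
      ((M (min (F.time k) t) (min (F.time (k + 1)) t)).adj ξ, y k) ∈
        (F.val k).star.graph (F.time k)) ∧
    v = ∑ k, y k

/-- A regular additive process (`incr s t` is `M(s,t)`, for `s ≤ t`) which is an integrator of
scalar type, with control measures `μ ξ` absolutely continuous with respect to Lebesgue measure. -/
structure ScalarIntegrator (S : Frame H) where
  incr : ℝ≥0 → ℝ≥0 → RandomVariable S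
  adapted : ∀ s t, s ≤ t → (incr s t).IsAdaptedAt t
  incr_self : ∀ t, (incr t t).op = 0
  incr_add : ∀ r s t, r ≤ s → s ≤ t → (incr r t).op = (incr r s).op + (incr s t).op
  regular : ∀ (ξ : S.D) (r s t : ℝ≥0), r ≤ s → s ≤ t → ∀ x ∈ S.cyclic r ξ,
    (∃ y, (x, y) ∈ (incr s t).closedGraph t) ∧ ∃ y, (x, y) ∈ (incr s t).star.closedGraph t
  regular_adj : ∀ (ξ : S.D) (s t : ℝ≥0), s ≤ t → (incr s t).adj ξ ∈ S.primeDomain s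
  J : S.D → Finset S.D
  J_trans : ∀ ξ, ∀ η ∈ J ξ, J η ⊆ J ξ
  bound : ℝ≥0 → S.D → ℝ≥0
  μ : S.D → Measure ℝ≥0
  μ_locallyFinite : ∀ ξ, IsLocallyFiniteMeasure (μ ξ)
  μ_noAtoms : ∀ ξ, NullSingletonClass (μ ξ)
  μ_absolutelyContinuous : ∀ ξ, μ ξ ≪ lebesgue
  left_bound : ∀ (F : SimpleProcess S) (t : ℝ≥0) (ξ : S.D) (v : H),
    F.IsLeftIntegral incr t ξ v →
      ‖v‖ₑ ^ 2 ≤ bound t ξ * ∫⁻ s in Iic t, ∑ η ∈ J ξ, ‖F.eval s η‖ₑ ^ 2 ∂(μ ξ)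
  right_bound : ∀ (F : SimpleProcess S) (t : ℝ≥0) (ξ : S.D) (v : H),
    F.IsRightAdjointIntegral incr t ξ v →
      ‖v‖ₑ ^ 2 ≤ bound t ξ * ∫⁻ s in Iic t, ∑ η ∈ J ξ, ‖F.evalAdj s η‖ₑ ^ 2 ∂(μ ξ)

/-- `v = ∫₀ᵗ dM F ξ`, the extension by continuity of the integral of simple processes: `v` is the
limit of the integrals of simple processes approximating `F` in the seminorms
`∫₀ᵗ ‖F_s η‖² dμ_ξ(s)`, `η ∈ J(ξ)`. By `left_bound`, there is at most one such `v`. -/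
def ScalarIntegrator.IsIntegral {S : Frame H} (M : ScalarIntegrator S)
    (F : ℝ≥0 → S.D → H) (t : ℝ≥0) (ξ : S.D) (v : H) : Prop :=
  ∀ ε : ℝ≥0∞, 0 < ε → ∃ (P : SimpleProcess S) (x : H),
    P.IsLeftIntegral M.incr t ξ x ∧ ‖x - v‖ₑ < ε ∧
    ∑ η ∈ M.J ξ, ∫⁻ s in Iic t, ‖P.eval s η - F s η‖ₑ ^ 2 ∂(M.μ ξ) < ε

/-- `v = [[M, N]](s,t) ξ`: `v` is the norm limit, as the mesh of the partition of `[s,t]` tends to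
zero, of `∑ₖ M(tₖ, tₖ₊₁) N(tₖ, tₖ₊₁) ξ`. -/
def IsMeyerBracket {S : Frame H} (M N : ScalarIntegrator S) (s t : ℝ≥0) (ξ : S.D) (v : H) : Prop :=
  ∀ ε : ℝ, 0 < ε → ∃ δ : ℝ, 0 < δ ∧ ∀ (n : ℕ) (p : ℕ → ℝ≥0), Monotone p → p 0 = s → p n = t →
    (∀ k < n, ((p (k + 1) : ℝ) - p k) < δ) →
    ∃ y : ℕ → H,
      (∀ k < n, ((N.incr (p k) (p (k + 1))).op ξ, y k) ∈
        (M.incr (p k) (p (k + 1))).closedGraph (p (k + 1))) ∧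
      ‖(∑ k ∈ Finset.range n, y k) - v‖ < ε

/-- `F` and `G` are adjoint to each other on `D`, at every time. -/
def IsFormalAdjoint (S : Frame H) (F G : ℝ≥0 → Module.End ℂ S.D) : Prop :=
  ∀ t (ξ η : S.D), inner ℂ (F t ξ : H) (η : H) = inner ℂ (ξ : H) (G t η : H)

theorem IsFormalAdjoint.symm {S : Frame H} {F G : ℝ≥0 → Module.End ℂ S.D}
    (h : IsFormalAdjoint S F G) : IsFormalAdjoint S G F := fun t ξ η => by
  rw [← inner_conj_symm, ← h t η ξ, inner_conj_symm]

end

/-! ## The algebra of processes -/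

section

variable {H : Type*} [NormedAddCommGroup H] [InnerProductSpace ℂ H] [CompleteSpace H]
  [TopologicalSpace.SeparableSpace H]

/-- Weak measurability on a dense subspace implies measurability. -/
theorem stronglyMeasurable_of_weak {D : Submodule ℂ H} (hD : Dense (D : Set H))
    {f : ℝ≥0 → H} (hf : ∀ ζ : D, Measurable fun t => inner ℂ (ζ : H) (f t)) :
    StronglyMeasurable f := by
  have h1 : ∀ ζ : H, Measurable fun t => inner ℂ ζ (f t) := by
    intro ζ
    obtain ⟨u, hu, hlim⟩ := mem_closure_iff_seq_limit.1 (hD ζ)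
    refine measurable_of_tendsto_metrizable (f := fun n t => inner ℂ (u n) (f t))
      (fun n => hf ⟨u n, hu n⟩) (tendsto_pi_nhds.2 fun t => ?_)
    exact Filter.Tendsto.inner hlim tendsto_const_nhds
  obtain ⟨w, b, hb⟩ := exists_hilbertBasis ℂ H
  have hw : Countable w := by
    have hpd : (Set.univ : Set w).PairwiseDisjoint fun i => Metric.ball (b i) (1 / 2) := by
      intro i _ j _ hij
      refine Metric.ball_disjoint_ball ?_
      have h2 : ‖b i - b j‖ ^ 2 = 2 := by
        have := @norm_sub_sq ℂ H _ _ _ (b i) (b j)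
        rw [b.orthonormal.1 i, b.orthonormal.1 j, b.orthonormal.2 hij] at this
        rw [this]; simp; norm_num
      rw [dist_eq_norm]
      nlinarith [norm_nonneg (b i - b j)]
    have := hpd.countable_of_isOpen (fun i _ => Metric.isOpen_ball)
      (fun i _ => ⟨b i, Metric.mem_ball_self (by norm_num)⟩)
    exact Set.countable_univ_iff.1 this
  refine stronglyMeasurable_of_tendsto (u := Filter.atTop)
    (f := fun (s : Finset w) t => ∑ i ∈ s, (inner ℂ (b i) (f t)) • b i) (fun s => ?_) ?_
  · exact Finset.stronglyMeasurable_fun_sum _ fun i _ => (h1 (b i)).stronglyMeasurable.smul_const _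
  · refine tendsto_pi_nhds.2 fun t => ?_
    have := b.hasSum_repr (f t)
    simpa [HasSum, HilbertBasis.repr_apply_apply] using this

theorem IsFormalAdjoint.measurable {S : Frame H} {F G : ℝ≥0 → Module.End ℂ S.D}
    (h : IsFormalAdjoint S F G) (hF : ∀ η, StronglyMeasurable fun t => (F t η : H)) (η : S.D) :
    StronglyMeasurable fun t => (G t η : H) := by
  refine stronglyMeasurable_of_weak S.dense_D fun ζ => ?_
  simp_rw [← h _ ζ η]
  exact ((hF ζ).inner stronglyMeasurable_const).measurable

/-- `W`, the algebra of processes leaving `D` invariant: families of operators on `D` having an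
adjoint on `D`, and Borel measurable in time on each vector of `D`. -/
def Frame.W (S : Frame H) : Subalgebra ℂ (ℝ≥0 → Module.End ℂ S.D) where
  carrier := {F | (∃ G, IsFormalAdjoint S F G) ∧ ∀ η, StronglyMeasurable fun t => (F t η : H)}
  mul_mem' := by
    rintro F F' ⟨⟨G, hG⟩, hF⟩ ⟨⟨G', hG'⟩, hF'⟩
    refine ⟨⟨G' * G, fun t ξ η => ?_⟩, fun η => stronglyMeasurable_of_weak S.dense_D fun ζ => ?_⟩
    · simp only [Pi.mul_apply, Module.End.mul_apply]
      rw [hG t, hG' t]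
    · have : (fun t => inner ℂ (ζ : H) ((F * F') t η : H))
          = fun t => inner ℂ (G t ζ : H) (F' t η : H) := by
        funext t
        simp only [Pi.mul_apply, Module.End.mul_apply]
        rw [hG.symm t]
      rw [this]
      exact ((hG.measurable hF ζ).inner (hF' η)).measurable
  add_mem' := by
    rintro F F' ⟨⟨G, hG⟩, hF⟩ ⟨⟨G', hG'⟩, hF'⟩
    refine ⟨⟨G + G', fun t ξ η => ?_⟩, fun η => ?_⟩
    · simp [inner_add_left, inner_add_right, hG t ξ η, hG' t ξ η]
    · exact (hF η).add (hF' η)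
  algebraMap_mem' := by
    intro c
    refine ⟨⟨fun _ => (starRingEnd ℂ c) • 1, fun t ξ η => ?_⟩, fun η => ?_⟩
    · simp [Algebra.algebraMap_eq_smul_one, inner_smul_left, inner_smul_right, mul_comm]
    · simpa [Algebra.algebraMap_eq_smul_one] using stronglyMeasurable_const

/-- The involution of the algebra of processes. -/
noncomputable def adj {S : Frame H} (F : S.W) : S.W :=
  ⟨F.2.1.choose, ⟨F.1, F.2.1.choose_spec.symm⟩, F.2.1.choose_spec.measurable F.2.2⟩

theorem adj_spec {S : Frame H} (F : S.W) : IsFormalAdjoint S F.1 (adj F).1 :=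
  F.2.1.choose_spec

/-- The random variable `F_t`. -/
noncomputable def rv {S : Frame H} (F : S.W) (t : ℝ≥0) : RandomVariable S where
  op := S.D.subtype ∘ₗ F.1 t
  adj := S.D.subtype ∘ₗ (adj F).1 t
  inner_adj := adj_spec F t

/-- Adapted processes. -/
def IsAdapted {S : Frame H} (F : S.W) : Prop := ∀ t, (rv F t).IsAdaptedAt t

/-- Locally bounded processes. -/
def IsLocallyBounded {S : Frame H} (F : S.W) : Prop :=
  ∀ T : ℝ≥0, ∃ C : ℝ, ∀ t ≤ T, ∀ ξ : S.D, ‖(F.1 t ξ : H)‖ ≤ C * ‖(ξ : H)‖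

/-- Processes strongly continuous on `D`. -/
def IsStronglyContinuous {S : Frame H} (F : S.W) : Prop :=
  ∀ ξ : S.D, Continuous fun t => (F.1 t ξ : H)

/-- `F` belongs to `L²_loc(dM)` on `[0,T]`. -/
def IntegrableUpTo {S : Frame H} (M : ScalarIntegrator S) (T : ℝ≥0) (F : S.W) : Prop :=
  IsAdapted F ∧ ∀ (ξ : S.D), ∀ η ∈ M.J ξ,
    ∫⁻ s in Iic T, (‖(F.1 s η : H)‖ₑ ^ 2 + ‖((adj F).1 s η : H)‖ₑ ^ 2) ∂(M.μ ξ) < ∞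

/-- `v = ∫₀ᵗ dM F ξ` for a process `F`. -/
def IsStochInt {S : Frame H} (M : ScalarIntegrator S) (F : S.W) (t : ℝ≥0) (ξ : S.D) (v : H) :
    Prop :=
  M.IsIntegral (fun s η => (F.1 s η : H)) t ξ v

/-- The family `M` is linearly independent: if `∑ₑ ∫₀ᵗ dMₑ Gₑ = 0` on `D` for all `t ≥ 0`, then
every `Gₑ` is the zero process (processes being identified when equal at almost all times). -/
def LinearlyIndependent {S : Frame H} {E : Type*} [Fintype E] (M : E → ScalarIntegrator S) : Prop :=
  ∀ G : E → S.W, (∀ e T, IntegrableUpTo (M e) T (G e)) →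
    (∀ (t : ℝ≥0) (ξ : S.D), ∃ v : E → H,
      (∀ e, IsStochInt (M e) (G e) t ξ (v e)) ∧ ∑ e, v e = 0) →
    ∀ e, ∀ᵐ t ∂lebesgue, (G e).1 t = 0

/-! ## The noises: commutation relations and Itô table -/

/-- The noises. The index `none` stands for `M₀` with `dM₀ = dτ`, `dτ(t) = density(t) dt`, and
`some a` for `M_a`, `a ∈ I`; `star` is `a ↦ a*` with `M_{a*} = (M_a)*`. -/
structure Noise (S : Frame H) (I : Type*) [Fintype I] where
  M : Option I → ScalarIntegrator S
  /-- The density of the real-valued measure `τ`. -/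
  density : ℝ≥0 → ℝ
  density_locallyIntegrable : LocallyIntegrable density lebesgue
  time_incr : ∀ s t, s ≤ t → ∀ ξ : S.D,
    ((M none).incr s t).op ξ = ((∫ r in Ioc s t, density r ∂lebesgue : ℝ) : ℂ) • (ξ : H)
  /-- The family `(M_a)` is self-adjoint. -/
  star : I → I
  star_incr : ∀ a s t, s ≤ t →
    ((M (some (star a))).incr s t).op = ((M (some a)).incr s t).adj
  /-- The map `j` with `j (a*) = a`. -/
  j : I → I
  j_star : ∀ a, j (star a) = a
  /-- The commutation automorphisms. -/
  ρ : I → (S.W ≃ₐ[ℂ] S.W)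
  ρ_adapted : ∀ a F, IsAdapted F → IsAdapted (ρ a F)
  ρ_ρ : ∀ a F, ρ a (ρ a F) = F
  /-- `M_a(s,t) F_s ξ = ρ_a(F_s) M_a(s,t) ξ`. -/
  comm_left : ∀ a F, IsAdapted F → ∀ (s t : ℝ≥0), s < t → ∀ ξ : S.D,
    (((M (some a)).incr s t).op ξ, ((M (some a)).incr s t).op (F.1 s ξ)) ∈ (rv (ρ a F) s).graph s
  /-- `F_s M_a(s,t) ξ = M_a(s,t) ρ_a(F_s) ξ`. -/
  comm_right : ∀ a F, IsAdapted F → ∀ (s t : ℝ≥0), s < t → ∀ ξ : S.D,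
    (((M (some a)).incr s t).op ξ, ((M (some a)).incr s t).op ((ρ a F).1 s ξ)) ∈ (rv F s).graph s
  /-- The structure processes: `c a b none` is `c₀(a,b)`, and `c a b (some ε)` is `c_ε(a,b)`. -/
  c : I → I → Option I → S.W
  c_integrable : ∀ a b e T, IntegrableUpTo (M e) T (c a b e)
  /-- The Itô table `dM_a dM_b = dτ c₀(a,b) + ∑_ε dM_ε c_ε(a,b)`. -/
  ito : ∀ a b (s t : ℝ≥0), s < t → ∀ ξ : S.D, ∃ u v : Option I → H,
    (∀ e, IsStochInt (M e) (c a b e) s ξ (u e)) ∧ (∀ e, IsStochInt (M e) (c a b e) t ξ (v e)) ∧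
    IsMeyerBracket (M (some a)) (M (some b)) s t ξ (∑ e, (v e - u e))
  /-- `dM_a dτ = dτ dM_a = 0`. -/
  ito_time : ∀ a (s t : ℝ≥0), s < t → ∀ ξ : S.D,
    IsMeyerBracket (M (some a)) (M none) s t ξ 0 ∧ IsMeyerBracket (M none) (M (some a)) s t ξ 0

variable {S : Frame H} {I : Type*} [Fintype I]

/-- The stochastic differential `dτ A + ∑_a dM_a B_a`, given by its coefficients. -/
def differential (A : S.W) (B : I → S.W) : Option I → S.W := fun e => e.elim A B

namespace Noise

variable (N : Noise S I)

/-- `dX = dτ Z₀ + ∑_a dM_a Z_a` on `[0,T]`, that is,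
`X(t) = X(0) + ∫₀ᵗ (dτ Z₀ + ∑_a dM_a Z_a)` on `D` for `0 ≤ t ≤ T`. -/
def HasDifferential (T : ℝ≥0) (X : S.W) (Z : Option I → S.W) : Prop :=
  (∀ e, IntegrableUpTo (N.M e) T (Z e)) ∧
  ∀ t ≤ T, ∀ ξ : S.D, ∃ v : Option I → H,
    (∀ e, IsStochInt (N.M e) (Z e) t ξ (v e)) ∧ (X.1 t ξ : H) = X.1 0 ξ + ∑ e, v e

/-- `dτ Z₀ + ∑_a dM_a Z_a = 0` on `[0,T]`, that is, the coefficients are integrable and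
`∫₀ᵗ (dτ Z₀ + ∑_a dM_a Z_a) = 0` on `D` for `0 ≤ t ≤ T`. -/
def DifferentialVanishes (T : ℝ≥0) (Z : Option I → S.W) : Prop :=
  (∀ e, IntegrableUpTo (N.M e) T (Z e)) ∧
  ∀ t ≤ T, ∀ ξ : S.D, ∃ v : Option I → H,
    (∀ e, IsStochInt (N.M e) (Z e) t ξ (v e)) ∧ ∑ e, v e = 0

end Noise

/-! ## Calculus of differentials

An expression is a sum `P + (dτ Z₀ + ∑_a dM_a Z_a)` of a process and a stochastic differential,
stored as the pair `(P, Z)`. -/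

/-- Sums of a process and a stochastic differential. -/
abbrev Expr (S : Frame H) (I : Type*) := S.W × (Option I → S.W)

/-- A process, as an expression. -/
def proc (P : S.W) : Expr S I := (P, 0)

/-- A differential, as an expression. -/
def diff (Z : Option I → S.W) : Expr S I := (0, Z)

/-- `dτ P`. -/
def dtau (P : S.W) : Expr S I := diff (differential P 0)

/-- `∑_a dM_a X_a`. -/
def dM (X : I → S.W) : Expr S I := diff (differential 0 X)

namespace Noise

variable (N : Noise S I)

/-- Transport of a process from the left to the right of `dMₑ`: `P dM_a = dM_a ρ_a(P)`, and
`P dτ = dτ P`. -/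
def transport : Option I → S.W → S.W
  | none, P => P
  | some a, P => N.ρ a P

/-- The product of two differentials, by the Itô table:
`(dM_a X)(dM_b Y) = dM_a dM_b ρ_b(X) Y = dτ c₀(a,b) ρ_b(X) Y + ∑_ε dM_ε c_ε(a,b) ρ_b(X) Y`,
all the products containing `dτ` being zero. -/
def itoProduct (Z Z' : Option I → S.W) : Option I → S.W := fun e =>
  ∑ a, ∑ b, N.c a b e * (N.ρ b (Z (some a)) * Z' (some b))

/-- The product of two expressions. -/
def mul (X Y : Expr S I) : Expr S I :=
  (X.1 * Y.1, fun e => N.transport e X.1 * Y.2 e + X.2 e * Y.1 + N.itoProduct X.2 Y.2 e)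

open Classical in
/-- The adjoint of an expression:
`(dτ X)* = X* dτ = dτ X*` and `(dM_a X)* = X* dM_{a*} = dM_{a*} ρ_{a*}(X*)`. -/
noncomputable def star' (X : Expr S I) : Expr S I :=
  (adj X.1, differential (adj (X.2 none))
    fun b => ∑ a with N.star a = b, N.ρ b (adj (X.2 (some a))))

end Noise

/-! ## The control problem and the Riccati equations -/

/-- The two problems: forward (initial condition, sign `+`) and backward (final condition,
sign `-`) evolution. -/
inductive Direction
  | forward
  | backward

/-- The sign `±`. -/
def Direction.sign : Direction → ℂ
  | forward => 1
  | backward => -1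

/-- The time at which the Riccati equation carries its boundary condition. -/
def Direction.boundaryTime (T : ℝ≥0) : Direction → ℝ≥0
  | forward => T
  | backward => 0

/-- Locally bounded adapted processes. -/
def IsCoefficient (X : S.W) : Prop := IsAdapted X ∧ IsLocallyBounded X

/-- Locally bounded, strongly continuous, adapted processes. -/
def IsWeight (X : S.W) : Prop := IsCoefficient X ∧ IsStronglyContinuous X

/-- The coefficients of the evolution `dX = ±(dτ (FX + Gu + L) + ∑_a dM_a F_a (wX + z))` on `[0,T]`
and of the quadratic criterion with weights `Q, R, m, η` and boundary operators `Qb`, `mb`. -/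
structure ControlData (S : Frame H) (I : Type*) (T : ℝ≥0) where
  (F G L w z : S.W)
  Fa : I → S.W
  (Q R Rinv m η : S.W)
  (Qb mb : H →L[ℂ] H)
  coeff_F : IsCoefficient F
  coeff_G : IsCoefficient G
  coeff_L : IsCoefficient L
  coeff_w : IsCoefficient w
  coeff_z : IsCoefficient z
  coeff_Fa : ∀ a, IsCoefficient (Fa a)
  weight_Q : IsWeight Q
  weight_R : IsWeight R
  weight_Rinv : IsWeight Rinv
  weight_m : IsWeight m
  weight_η : IsWeight η
  R_mul_Rinv : R * Rinv = 1
  Rinv_mul_R : Rinv * R = 1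
  Q_nonneg : ∀ t ≤ T, ∀ ξ : S.D, ∃ q : ℝ, 0 ≤ q ∧ inner ℂ (ξ : H) (Q.1 t ξ : H) = q
  R_nonneg : ∀ t ≤ T, ∀ ξ : S.D, ∃ q : ℝ, 0 ≤ q ∧ inner ℂ (ξ : H) (R.1 t ξ : H) = q
  Rinv_pos : ∀ t ≤ T, ∀ ξ : S.D, ξ ≠ 0 → ∃ q : ℝ, 0 < q ∧ inner ℂ (ξ : H) (Rinv.1 t ξ : H) = q
  Qb_nonneg : Qb.IsPositive

namespace ControlData

variable {T : ℝ≥0} (K : ControlData S I T) (N : Noise S I) (d : Direction)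

/-- `∑_a dM_a F_a w`. -/
def Nw : Expr S I := dM fun a => K.Fa a * K.w

/-- `∑_a dM_a F_a z`. -/
def Nz : Expr S I := dM fun a => K.Fa a * K.z

/-- The left-hand side of the Riccati equation, for `dΠ = dτ Z₀ + ∑_a dM_a Z_a`:
`dτ (F*Π + ΠF + Q - ΠGR⁻¹G*Π) + Nw* Π + Π Nw ± Nw* Π Nw ± (Nw ± id)* dΠ (Nw ± id)`. -/
noncomputable def riccati (P : S.W) (Z : Option I → S.W) : Expr S I :=
  dtau (adj K.F * P + P * K.F + K.Q - P * K.G * K.Rinv * adj K.G * P)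
    + N.mul (N.star' K.Nw) (proc P)
    + N.mul (proc P) K.Nw
    + d.sign • N.mul (N.mul (N.star' K.Nw) (proc P)) K.Nw
    + d.sign • N.mul (N.mul (N.star' (K.Nw + d.sign • proc 1)) (diff Z)) (K.Nw + d.sign • proc 1)

/-- The left-hand side of the equation for `r`, for `dΠ = dτ Z₀ + ∑_a dM_a Z_a` and
`dr = dτ Y₀ + ∑_a dM_a Y_a`:
`dτ (F*r - ΠGR⁻¹G*r + ΠL + m* - ΠGR⁻¹η*) + Nw* r + Π Nz + dΠ Nz ± Nw* Π Nz ± Nw* dΠ Nz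
+ (Nw ± id)* dr`. -/
noncomputable def affine (P : S.W) (Z : Option I → S.W) (r : S.W) (Y : Option I → S.W) : Expr S I :=
  dtau (adj K.F * r - P * K.G * K.Rinv * adj K.G * r + P * K.L + adj K.m
      - P * K.G * K.Rinv * adj K.η)
    + N.mul (N.star' K.Nw) (proc r)
    + N.mul (proc P) K.Nz
    + N.mul (diff Z) K.Nz
    + d.sign • N.mul (N.mul (N.star' K.Nw) (proc P)) K.Nz
    + d.sign • N.mul (N.mul (N.star' K.Nw) (diff Z)) K.Nz
    + N.mul (N.star' (K.Nw + d.sign • proc 1)) (diff Y)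

/-- `Π` solves the Riccati equation on `[0,T]`: it has a stochastic differential, for which the
left-hand side vanishes, and it satisfies the boundary condition. -/
def SolvesRiccati (P : S.W) : Prop :=
  (∃ Z, N.HasDifferential T P Z ∧ N.DifferentialVanishes T (K.riccati N d P Z).2) ∧
    ∀ ξ : S.D, (P.1 (d.boundaryTime T) ξ : H) = K.Qb ξ

/-- `r` solves its equation on `[0,T]`, where `dΠ = dτ Z₀ + ∑_a dM_a Z_a`. -/
def SolvesAffine (P : S.W) (Z : Option I → S.W) (r : S.W) : Prop :=
  (∃ Y, N.HasDifferential T r Y ∧ N.DifferentialVanishes T (K.affine N d P Z r Y).2) ∧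
    ∀ ξ : S.D, (r.1 (d.boundaryTime T) ξ : H) = ContinuousLinearMap.adjoint K.mb ξ

/-! ### The operator equations -/

/-- `ρ_a(w* F_{j(a)}*)`. -/
noncomputable def κ (a : I) : S.W := N.ρ a (adj K.w * adj (K.Fa (N.j a)))

/-- The `dτ` part of the operator equations for `A`, `B_a`. -/
noncomputable def riccatiEq₀ (P A : S.W) (B : I → S.W) : S.W :=
  adj K.F * P + P * K.F + K.Q - P * K.G * K.Rinv * adj K.G * P + d.sign • A
    + ∑ a, ∑ b,
      (d.sign • (N.c a b none * N.ρ b (K.κ N a * P) * K.Fa b * K.w)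
        + N.c a b none * N.ρ b (K.κ N a) * B b
        + N.c a b none * N.ρ b (B a) * K.Fa b * K.w
        + d.sign • ∑ γ, ∑ ε, N.c ε γ none * N.ρ γ (N.c a b (some ε))
            * N.ρ γ (N.ρ b (K.κ N a) * B b) * K.Fa γ * K.w)

/-- The `dM_J` part of the operator equations for `A`, `B_a`. -/
noncomputable def riccatiEq (P : S.W) (B : I → S.W) (J : I) : S.W :=
  K.κ N J * P + N.ρ J P * K.Fa J * K.w + d.sign • B J
    + ∑ a, ∑ b,
      (d.sign • (N.c a b (some J) * N.ρ b (K.κ N a * P) * K.Fa b * K.w)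
        + N.c a b (some J) * N.ρ b (K.κ N a) * B b
        + N.c a b (some J) * N.ρ b (B a) * K.Fa b * K.w
        + d.sign • ∑ γ, ∑ ε, N.c ε γ (some J) * N.ρ γ (N.c a b (some ε))
            * N.ρ γ (N.ρ b (K.κ N a) * B b) * K.Fa γ * K.w)

/-- The `dτ` part of the operator equations for `C`, `D_a`. -/
noncomputable def affineEq₀ (P : S.W) (B : I → S.W) (r C : S.W) (D : I → S.W) : S.W :=
  adj K.F * r - P * K.G * K.Rinv * adj K.G * r + P * K.L + adj K.m - P * K.G * K.Rinv * adj K.η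
    + d.sign • C
    + ∑ a, ∑ b,
      (N.c a b none * N.ρ b (B a) * K.Fa b * K.z
        + d.sign • (N.c a b none * N.ρ b (K.κ N a * P) * K.Fa b * K.z)
        + N.c a b none * N.ρ b (K.κ N a) * D b
        + d.sign • ∑ γ, ∑ ε, N.c ε γ none * N.ρ γ (N.c a b (some ε))
            * N.ρ γ (N.ρ b (K.κ N a) * B b) * K.Fa γ * K.z)

/-- The `dM_J` part of the operator equations for `C`, `D_a`. -/
noncomputable def affineEq (P : S.W) (B : I → S.W) (r : S.W) (D : I → S.W) (J : I) : S.W :=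
  K.κ N J * r + N.ρ J P * K.Fa J * K.z + d.sign • D J
    + ∑ a, ∑ b,
      (N.c a b (some J) * N.ρ b (B a) * K.Fa b * K.z
        + d.sign • (N.c a b (some J) * N.ρ b (K.κ N a * P) * K.Fa b * K.z)
        + N.c a b (some J) * N.ρ b (K.κ N a) * D b
        + d.sign • ∑ γ, ∑ ε, N.c ε γ (some J) * N.ρ γ (N.c a b (some ε))
            * N.ρ γ (N.ρ b (K.κ N a) * B b) * K.Fa γ * K.z)

end ControlData

/-- `X(t) = 0` for `0 ≤ t ≤ T`: for almost every `t`, and for every `t` when `X` is strongly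
continuous on `D` over `[0,T]`. -/
def VanishesOn (T : ℝ≥0) (X : S.W) : Prop :=
  (∀ᵐ t ∂lebesgue, t ≤ T → X.1 t = 0) ∧
    ((∀ ξ : S.D, ContinuousOn (fun t => (X.1 t ξ : H)) (Iic T)) → ∀ t ≤ T, X.1 t = 0)

end

end AFQ

namespace AFQ

/-! ## The half-line -/

/-! The proof separates algebra from analysis.

Algebra: once differentials are written `dτ A + ∑ dM_a B_a` and `dτ C + ∑ dM_a D_a`, the calculus
turns the left-hand sides of (R) and (r) into a single differential each. Its coefficients are
exactly the left-hand sides of the operator equations, as an identity in the algebra `W`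
(`riccati_snd_none`, `riccati_snd_some`, `affine_snd_none`, `affine_snd_some`). The inputs are the
adjoint formula `(∑ dM_a F_a w)* = ∑ dM_a K_a`, the fact that the sign is real with square one, and
the expansion of a triple Itô product, where the `dτ` part of the inner product is lost because `dτ
dM_γ = 0`.

Analysis: an adapted differential vanishes on `[0,T]` if and only if each coefficient does
(`Noise.differentialVanishes_iff`). Linear independence is a statement about all of `[0,∞)`, so the
coefficients are multiplied by `χ_[0,T)`. The integrals up to `t < T` do not change, and those up to
`t ≥ T` equal the integral up to `T`, so they all vanish and independence applies. Conversely,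
coefficients that are zero almost everywhere are integrable with zero integral, the control measures
being absolutely continuous. The pointwise form for strongly continuous coefficients follows because
Lebesgue measure charges nonempty open sets. -/

theorem measurableEmbedding_coe_nnreal : MeasurableEmbedding ((↑) : ℝ≥0 → ℝ) :=
  MeasurableEmbedding.subtype_coe measurableSet_Ici

theorem lebesgue_singleton (t : ℝ≥0) : lebesgue {t} = 0 := by
  rw [lebesgue, measurableEmbedding_coe_nnreal.comap_apply]
  simp

/-- A relatively open set containing `0` need not be open in `ℝ`. It does contain a positive point,
so its positive part is a nonempty open subset of `ℝ`, which has positive measure. -/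
instance : lebesgue.IsOpenPosMeasure where
  open_pos U hU hne := by
    obtain ⟨a, ha⟩ := hne
    have hcl : a ∈ closure (Ioi (0 : ℝ≥0)) := by
      rw [closure_Ioi' ⟨1, one_pos⟩]; exact mem_Ici.2 bot_le
    obtain ⟨b, hbU, hb⟩ := mem_closure_iff.1 hcl U hU ha
    have hV : IsOpen {x : ℝ | 0 < x ∧ x.toNNReal ∈ U} :=
      (isOpen_lt continuous_const continuous_id).inter (hU.preimage continuous_real_toNNReal)
    have hsub : {x : ℝ | 0 < x ∧ x.toNNReal ∈ U} ⊆ ((↑) : ℝ≥0 → ℝ) '' U := fun x hx =>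
      ⟨x.toNNReal, hx.2, Real.coe_toNNReal x hx.1.le⟩
    rw [lebesgue, measurableEmbedding_coe_nnreal.comap_apply]
    have hbV : (b : ℝ) ∈ {x : ℝ | 0 < x ∧ x.toNNReal ∈ U} := by
      refine ⟨by exact_mod_cast hb, ?_⟩
      simpa using hbU
    exact ne_of_gt ((hV.measure_pos volume ⟨b, hbV⟩).trans_le (measure_mono hsub))

section

variable {H : Type*} [NormedAddCommGroup H] [InnerProductSpace ℂ H] [CompleteSpace H] {S : Frame H}

/-! ## Random variables and truncation of simple processes -/

theorem RandomVariable.isAdaptedAt_of_op_eq_zero {F : RandomVariable S} {t : ℝ≥0}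
    (h : F.op = 0) (h' : F.adj = 0) : F.IsAdaptedAt t :=
  ⟨0, 0, by simp, by simp [h, h']⟩

/-- An extension to `D'_t` of an operator leaving `D` invariant leaves `D'_t` invariant. -/
theorem Frame.extension_mem_primeDomain {t : ℝ≥0} {X : S.primeDomain t →ₗ[ℂ] H}
    {F : Module.End ℂ S.D}
    (h : ∀ (α : H →L[ℂ] H) (hα : α ∈ (S.alg t).commutant) (ξ : S.D),
      X ⟨α ξ, S.mem_primeDomain t hα ξ⟩ = α (F ξ)) (x : S.primeDomain t) :
    X x ∈ S.primeDomain t := by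
  obtain ⟨x, hx⟩ := x
  refine Submodule.span_induction (p := fun x hx => X ⟨x, hx⟩ ∈ S.primeDomain t)
    ?_ ?_ ?_ ?_ hx
  · rintro x ⟨α, hα, ξ, rfl⟩
    rw [h α hα ξ]
    exact S.mem_primeDomain t hα _
  · have : X ⟨0, (S.primeDomain t).zero_mem⟩ = 0 := X.map_zero
    rw [this]
    exact Submodule.zero_mem _
  · intro x y hx hy hX hY
    have : X ⟨x + y, (S.primeDomain t).add_mem hx hy⟩ = X ⟨x, hx⟩ + X ⟨y, hy⟩ :=
      X.map_add ⟨x, hx⟩ ⟨y, hy⟩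
    rw [this]
    exact Submodule.add_mem _ hX hY
  · intro c x hx hX
    have : X ⟨c • x, (S.primeDomain t).smul_mem c hx⟩ = c • X ⟨x, hx⟩ :=
      X.map_smul c ⟨x, hx⟩
    rw [this]
    exact Submodule.smul_mem _ c hX

instance : Zero (RandomVariable S) := ⟨⟨0, 0, by simp⟩⟩

theorem RandomVariable.zero_op : (0 : RandomVariable S).op = 0 := rfl

/-- The graph lies in the closed subspace `H × 0`, hence so does its closure. -/
theorem RandomVariable.snd_eq_zero_of_mem_closedGraph {F : RandomVariable S} (hF : F.op = 0)
    {t : ℝ≥0} {p : H × H} (hp : p ∈ F.closedGraph t) : p.2 = 0 := by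
  have hle : F.graph t ≤ LinearMap.ker (LinearMap.snd ℂ H H) := by
    refine Submodule.span_le.2 ?_
    rintro _ ⟨α, hα, ξ, rfl⟩
    simp [hF]
  have hcl : IsClosed ((LinearMap.ker (LinearMap.snd ℂ H H) : Submodule ℂ (H × H)) : Set (H × H)) :=
    isClosed_singleton.preimage continuous_snd
  exact (Submodule.topologicalClosure_minimal _ hle hcl) hp

open Classical in
/-- The simple process `χ_[0,T) F`. -/
noncomputable def SimpleProcess.killAt (T : ℝ≥0) (F : SimpleProcess S) : SimpleProcess S where
  n := F.n
  time k := min (F.time k) T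
  time_mono := F.time_mono.min monotone_const
  -- A value attached to a time after `T` need not be adapted at the truncated time `T`. Its
  -- interval becomes the empty `[T,T)`, so replacing it by zero costs nothing.
  val k := if F.time k ≤ T then F.val k else 0
  adapted k := by
    split_ifs with h
    · rw [min_eq_left h]
      exact F.adapted k
    · exact RandomVariable.isAdaptedAt_of_op_eq_zero rfl rfl

theorem SimpleProcess.eval_killAt_of_lt {T s : ℝ≥0} (F : SimpleProcess S) (h : s < T) (η : S.D) :
    (F.killAt T).eval s η = F.eval s η := by
  unfold SimpleProcess.eval
  refine Finset.sum_congr rfl fun (k : Fin F.n) _ => ?_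
  by_cases hk : F.time k ≤ T
  · simp only [SimpleProcess.killAt, hk, if_true]
    simp only [indicator, mem_Ico, min_le_iff, lt_min_iff, h, h.not_ge, and_true, or_false]
  · have h1 : ¬ F.time k ≤ s := fun h' => hk (h'.trans h.le)
    simp [SimpleProcess.killAt, hk, h1, indicator, RandomVariable.zero_op]

theorem SimpleProcess.eval_killAt_of_le {T s : ℝ≥0} (F : SimpleProcess S) (h : T ≤ s) (η : S.D) :
    (F.killAt T).eval s η = 0 := by
  unfold SimpleProcess.eval
  refine Finset.sum_eq_zero fun (k : Fin F.n) _ => ?_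
  refine indicator_of_notMem (fun hs => ?_) _
  exact (hs.2.trans_le (min_le_right _ _)).not_ge h

/-- The same summands serve both integrals: cutting at `T` and then at `t ≥ T` is cutting at `T`.
Steps starting after `T` see only the increment `M(T,T) = 0`. -/
theorem SimpleProcess.IsLeftIntegral.killAt {M : ScalarIntegrator S} {T t : ℝ≥0}
    {F : SimpleProcess S} {ξ : S.D} {v : H} (h : F.IsLeftIntegral M.incr T ξ v) (ht : T ≤ t) :
    (F.killAt T).IsLeftIntegral M.incr t ξ v := by
  obtain ⟨y, hy, rfl⟩ := h
  refine ⟨y, fun (k : Fin F.n) => ?_, rfl⟩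
  have key := hy k
  have hmin : ∀ a : ℝ≥0, min (min a T) t = min a T := fun a =>
    min_eq_left ((min_le_right _ _).trans ht)
  simp only [SimpleProcess.killAt, hmin]
  split_ifs with hk
  · exact key
  · have hk' : T ≤ F.time k := (not_le.1 hk).le
    have hk'' : T ≤ F.time (k + 1) := hk'.trans (F.time_mono (Nat.le_succ _))
    rw [min_eq_right hk', min_eq_right hk''] at key ⊢
    have h0 : y k = 0 := RandomVariable.snd_eq_zero_of_mem_closedGraph (M.incr_self T) key
    rw [h0]
    exact Submodule.zero_mem _

end

section

variable {H : Type*} [NormedAddCommGroup H] [InnerProductSpace ℂ H] [CompleteSpace H]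
  [TopologicalSpace.SeparableSpace H] {S : Frame H}

/-! ## The involution of the algebra of processes -/

/-- `adj` is obtained by choice. Density of `D` makes the adjoint unique, so every identity for
`adj` can be checked on inner products. -/
theorem adj_eq_of_isFormalAdjoint {F G : S.W} (h : IsFormalAdjoint S F.1 G.1) : adj F = G := by
  refine Subtype.ext (funext fun t => LinearMap.ext fun η => Subtype.ext ?_)
  refine S.dense_D.eq_of_inner_right ℂ fun v hv => ?_
  rw [← adj_spec F t ⟨v, hv⟩ η, ← h t ⟨v, hv⟩ η]

theorem adj_zero : adj (0 : S.W) = 0 :=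
  adj_eq_of_isFormalAdjoint fun t ξ η => by simp

theorem adj_one : adj (1 : S.W) = 1 :=
  adj_eq_of_isFormalAdjoint fun t ξ η => by simp

theorem adj_add (F G : S.W) : adj (F + G) = adj F + adj G :=
  adj_eq_of_isFormalAdjoint fun t ξ η => by
    have hF := adj_spec F t ξ η
    have hG := adj_spec G t ξ η
    simp only [Subalgebra.coe_add, Pi.add_apply, LinearMap.add_apply, Submodule.coe_add,
      inner_add_left, inner_add_right, hF, hG]

theorem adj_smul (c : ℂ) (F : S.W) : adj (c • F) = (starRingEnd ℂ c) • adj F :=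
  adj_eq_of_isFormalAdjoint fun t ξ η => by
    have hF := adj_spec F t ξ η
    simp only [Subalgebra.coe_smul, Pi.smul_apply, LinearMap.smul_apply, Submodule.coe_smul,
      inner_smul_left, inner_smul_right, hF]

theorem adj_mul (F G : S.W) : adj (F * G) = adj G * adj F :=
  adj_eq_of_isFormalAdjoint fun t ξ η => by
    simp only [Subalgebra.coe_mul, Pi.mul_apply, Module.End.mul_apply]
    rw [adj_spec F t, adj_spec G t]

theorem adj_adj (F : S.W) : adj (adj F) = F :=
  adj_eq_of_isFormalAdjoint (adj_spec F).symm

theorem adj_apply_eq_zero {F : S.W} {t : ℝ≥0} (h : F.1 t = 0) : (adj F).1 t = 0 := by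
  refine LinearMap.ext fun η => Subtype.ext ?_
  refine S.dense_D.eq_of_inner_right ℂ fun v hv => ?_
  rw [← adj_spec F t ⟨v, hv⟩ η, h]
  simp

/-! ## Adapted processes -/

theorem IsAdapted.adj {F : S.W} (hF : IsAdapted F) : IsAdapted (adj F) := fun t => by
  obtain ⟨X, Y, hXY, h⟩ := hF t
  refine ⟨Y, X, fun x y => ?_, fun α hα ξ => ⟨(h α hα ξ).2, ?_⟩⟩
  · rw [← inner_conj_symm, ← hXY y x, inner_conj_symm]
  · rw [(h α hα ξ).1]
    simp [rv, adj_adj]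

theorem isAdapted_zero : IsAdapted (0 : S.W) := fun t =>
  RandomVariable.isAdaptedAt_of_op_eq_zero (by ext; simp [rv]) (by ext; simp [rv, adj_zero])

theorem IsAdapted.add {F G : S.W} (hF : IsAdapted F) (hG : IsAdapted G) : IsAdapted (F + G) :=
  fun t => by
    obtain ⟨X, Y, hXY, h⟩ := hF t
    obtain ⟨X', Y', hXY', h'⟩ := hG t
    refine ⟨X + X', Y + Y', fun x y => ?_, fun α hα ξ => ⟨?_, ?_⟩⟩
    · simp [inner_add_left, inner_add_right, hXY, hXY']
    · simp [(h α hα ξ).1, (h' α hα ξ).1, rv]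
    · simp [(h α hα ξ).2, (h' α hα ξ).2, rv, adj_add]

theorem IsAdapted.smul {F : S.W} (hF : IsAdapted F) (c : ℂ) : IsAdapted (c • F) := fun t => by
  obtain ⟨X, Y, hXY, h⟩ := hF t
  refine ⟨c • X, (starRingEnd ℂ c) • Y, fun x y => ?_, fun α hα ξ => ⟨?_, ?_⟩⟩
  · simp [inner_smul_left, inner_smul_right, hXY, mul_comm]
  · simp [(h α hα ξ).1, rv]
  · simp [(h α hα ξ).2, rv, adj_smul]

theorem IsAdapted.sub {F G : S.W} (hF : IsAdapted F) (hG : IsAdapted G) : IsAdapted (F - G) := by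
  have := hF.add (hG.smul (-1))
  have e : F - G = F + (-1 : ℂ) • G := by
    refine Subtype.ext ?_
    simp only [Subalgebra.coe_sub, Subalgebra.coe_add, Subalgebra.coe_smul, neg_smul, one_smul,
      sub_eq_add_neg]
  rwa [e]

theorem IsAdapted.mul {F G : S.W} (hF : IsAdapted F) (hG : IsAdapted G) : IsAdapted (F * G) :=
  fun t => by
    obtain ⟨X, Y, hXY, h⟩ := hF t
    obtain ⟨X', Y', hXY', h'⟩ := hG t
    -- The extensions can be composed because elements of `W` preserve `D`, so that their extensions
    -- preserve `D'_t`.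
    have hX' := S.extension_mem_primeDomain (F := G.1 t) fun α hα ξ => (h' α hα ξ).1
    have hY := S.extension_mem_primeDomain (F := (AFQ.adj F).1 t) fun α hα ξ => (h α hα ξ).2
    refine ⟨X ∘ₗ X'.codRestrict _ hX', Y' ∘ₗ Y.codRestrict _ hY, fun x y => ?_,
      fun α hα ξ => ⟨?_, ?_⟩⟩
    · simp only [LinearMap.comp_apply]
      rw [hXY, ← hXY']
      rfl
    · have e : X'.codRestrict _ hX' ⟨α ξ, S.mem_primeDomain t hα ξ⟩ =
          ⟨α (G.1 t ξ), S.mem_primeDomain t hα _⟩ := Subtype.ext (h' α hα ξ).1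
      rw [LinearMap.comp_apply, e, (h α hα _).1]
      rfl
    · have e : Y.codRestrict _ hY ⟨α ξ, S.mem_primeDomain t hα ξ⟩ =
          ⟨α ((AFQ.adj F).1 t ξ), S.mem_primeDomain t hα _⟩ := Subtype.ext (h α hα ξ).2
      rw [LinearMap.comp_apply, e, (h' α hα _).2]
      simp [rv, adj_mul]

theorem isAdapted_sum {ι : Type*} {s : Finset ι} {F : ι → S.W} (h : ∀ i ∈ s, IsAdapted (F i)) :
    IsAdapted (∑ i ∈ s, F i) :=
  Finset.sum_induction F IsAdapted (fun _ _ => IsAdapted.add) isAdapted_zero h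

/-! ## Killing a process from a given time on -/

open Classical in
/-- The process `χ_[0,T) F`. -/
noncomputable def killAt (T : ℝ≥0) (F : S.W) : S.W :=
  ⟨fun t => if t < T then F.1 t else 0,
    ⟨fun t => if t < T then (adj F).1 t else 0, fun t ξ η => by
      by_cases h : t < T
      · simpa [h] using adj_spec F t ξ η
      · simp [h]⟩,
    fun η => by
      have : (fun t => (((if t < T then F.1 t else 0) η : S.D) : H)) =
          (Iio T).indicator fun t => (F.1 t η : H) := by
        funext t
        by_cases h : t < T <;> simp [h]
      simp only [this]
      exact (F.2.2 η).indicator measurableSet_Iio⟩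

theorem killAt_of_lt {T t : ℝ≥0} (F : S.W) (h : t < T) : (killAt T F).1 t = F.1 t := if_pos h

theorem killAt_of_le {T t : ℝ≥0} (F : S.W) (h : T ≤ t) : (killAt T F).1 t = 0 := if_neg h.not_gt

theorem adj_killAt (T : ℝ≥0) (F : S.W) : adj (killAt T F) = killAt T (adj F) :=
  adj_eq_of_isFormalAdjoint fun t ξ η => by
    rcases lt_or_ge t T with h | h
    · simpa only [killAt_of_lt _ h] using adj_spec F t ξ η
    · simp [killAt_of_le _ h]

theorem IsAdapted.killAt {F : S.W} (hF : IsAdapted F) (T : ℝ≥0) : IsAdapted (killAt T F) :=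
  fun t => by
    rcases lt_or_ge t T with h | h
    · have : rv (AFQ.killAt T F) t = rv F t := by
        simp only [rv, adj_killAt, killAt_of_lt _ h]
      rw [this]
      exact hF t
    · refine RandomVariable.isAdaptedAt_of_op_eq_zero ?_ ?_
      · simp [rv, killAt_of_le _ h]
      · simp [rv, adj_killAt, killAt_of_le _ h]

/-- Truncation turns integrability up to the fixed time `T` into integrability up to every time, as
linear independence demands. -/
theorem IntegrableUpTo.killAt {M : ScalarIntegrator S} {T : ℝ≥0} {F : S.W}
    (hF : IntegrableUpTo M T F) (T' : ℝ≥0) : IntegrableUpTo M T' (killAt T F) := by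
  refine ⟨hF.1.killAt T, fun ξ η hη => ?_⟩
  refine lt_of_le_of_lt ?_ (hF.2 ξ η hη)
  refine (setLIntegral_le_lintegral _ _).trans ?_
  rw [← lintegral_indicator measurableSet_Iic]
  refine lintegral_mono fun s => ?_
  rcases lt_or_ge s T with h | h
  · rw [adj_killAt, killAt_of_lt _ h, killAt_of_lt _ h, indicator_of_mem (mem_Iic.2 h.le)]
  · rw [adj_killAt, killAt_of_le _ h, killAt_of_le _ h]
    simp

/-! ## Stochastic integrals of vanishing and of truncated processes -/

/-- An approximating simple process truncated at `T` has the same integral, and its error over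
`[0,t]` is at most the original error over `[0,T]`. -/
theorem IsStochInt.killAt_of_le {M : ScalarIntegrator S} {T t : ℝ≥0} {F : S.W} {ξ : S.D} {v : H}
    (h : IsStochInt M F T ξ v) (ht : T ≤ t) : IsStochInt M (killAt T F) t ξ v := by
  intro ε hε
  obtain ⟨P, x, hx, hxv, hP⟩ := h ε hε
  refine ⟨P.killAt T, x, hx.killAt ht, hxv, lt_of_le_of_lt (Finset.sum_le_sum fun η _ => ?_) hP⟩
  refine (setLIntegral_le_lintegral _ _).trans ?_
  rw [← lintegral_indicator measurableSet_Iic]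
  refine lintegral_mono fun s => ?_
  rcases lt_or_ge s T with h | h
  · simp only [killAt_of_lt _ h, P.eval_killAt_of_lt h, indicator_of_mem (mem_Iic.2 h.le), le_refl]
  · simp [AFQ.killAt_of_le _ h, P.eval_killAt_of_le h]

/-- For `t` strictly below `T` the two integrands coincide on all of `[0,t]`, so the approximants
need no change. -/
theorem IsStochInt.killAt_of_lt {M : ScalarIntegrator S} {T t : ℝ≥0} {F : S.W} {ξ : S.D} {v : H}
    (h : IsStochInt M F t ξ v) (ht : t < T) : IsStochInt M (killAt T F) t ξ v := by
  intro ε hε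
  obtain ⟨P, x, hx, hxv, hP⟩ := h ε hε
  refine ⟨P, x, hx, hxv, lt_of_eq_of_lt (Finset.sum_congr rfl fun η _ => ?_) hP⟩
  refine setLIntegral_congr_fun measurableSet_Iic fun s hs => ?_
  simp only [AFQ.killAt_of_lt F (lt_of_le_of_lt (mem_Iic.1 hs) ht)]

/-- The simple process without steps approximates `F` with zero error, since the control measure
ignores Lebesgue-null sets. -/
theorem isStochInt_zero {M : ScalarIntegrator S} {T t : ℝ≥0} {F : S.W}
    (hF : ∀ᵐ s ∂lebesgue, s ≤ T → F.1 s = 0) (ht : t ≤ T) (ξ : S.D) : IsStochInt M F t ξ 0 := by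
  intro ε hε
  refine ⟨⟨0, fun _ => 0, monotone_const, Fin.elim0, fun k => k.elim0⟩, 0,
    ⟨Fin.elim0, fun k => k.elim0, by simp⟩, by simpa using hε, ?_⟩
  refine lt_of_eq_of_lt (Finset.sum_eq_zero fun η _ => ?_) hε
  refine (setLIntegral_congr_fun_ae measurableSet_Iic ?_).trans lintegral_zero
  filter_upwards [(M.μ_absolutelyContinuous ξ).ae_le hF] with s hs hst
  simp [hs ((mem_Iic.1 hst).trans ht), SimpleProcess.eval]

theorem integrableUpTo_of_ae_eq_zero {M : ScalarIntegrator S} {T : ℝ≥0} {F : S.W}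
    (hF : IsAdapted F) (h0 : ∀ᵐ s ∂lebesgue, s ≤ T → F.1 s = 0) : IntegrableUpTo M T F := by
  refine ⟨hF, fun ξ η _ => ?_⟩
  refine lt_of_eq_of_lt ((setLIntegral_congr_fun_ae measurableSet_Iic ?_).trans lintegral_zero)
    ENNReal.zero_lt_top
  filter_upwards [(M.μ_absolutelyContinuous ξ).ae_le h0] with s hs hst
  simp [hs hst, adj_apply_eq_zero (hs hst)]

/-! ## Vanishing differentials -/

/-- Continuous functions that agree almost everywhere on `[0,T]` agree on the closure of its
interior. This closure is all of `[0,T]` because `T > 0`; the single point `{0}` would be a null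
set. -/
theorem vanishesOn_iff {T : ℝ≥0} (hT : 0 < T) {X : S.W} :
    VanishesOn T X ↔ ∀ᵐ t ∂lebesgue, t ≤ T → X.1 t = 0 := by
  refine ⟨fun h => h.1, fun h => ⟨h, fun hc t ht => LinearMap.ext fun ξ => Subtype.ext ?_⟩⟩
  have hae : (fun t => (X.1 t ξ : H)) =ᵐ[lebesgue.restrict (Iic T)] fun _ => 0 := by
    refine (ae_restrict_iff' measurableSet_Iic).2 ?_
    filter_upwards [h] with s hs hst
    simp [hs hst]
  refine Measure.eqOn_of_ae_eq hae (hc ξ) continuousOn_const ?_ ht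
  have hcl : closure (Iio T) = Iic T := closure_Iio' ⟨0, hT⟩
  rw [← hcl]
  exact closure_mono (interior_maximal (by rw [hcl]; exact Iio_subset_Iic_self) isOpen_Iio)

variable {I : Type*} [Fintype I]

/-- This is where linear independence enters: it allows coefficients to be compared on the bounded
interval. -/
theorem Noise.differentialVanishes_iff (N : Noise S I) (hN : LinearlyIndependent N.M) {T : ℝ≥0}
    (hT : 0 < T) {Z : Option I → S.W} (hZ : ∀ e, IsAdapted (Z e)) :
    N.DifferentialVanishes T Z ↔ ∀ e, VanishesOn T (Z e) := by
  simp only [vanishesOn_iff hT]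
  refine ⟨fun h => ?_, fun h => ⟨fun e => integrableUpTo_of_ae_eq_zero (hZ e) (h e),
    fun t ht ξ => ⟨0, fun e => isStochInt_zero (h e) ht ξ, by simp⟩⟩⟩
  have key := hN (fun e => killAt T (Z e)) (fun e T' => (h.1 e).killAt T') fun t ξ => by
    rcases lt_or_ge t T with ht | ht
    · obtain ⟨v, hv, hv0⟩ := h.2 t ht.le ξ
      exact ⟨v, fun e => (hv e).killAt_of_lt ht, hv0⟩
    · obtain ⟨v, hv, hv0⟩ := h.2 T le_rfl ξ
      exact ⟨v, fun e => (hv e).killAt_of_le ht, hv0⟩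
  intro e
  -- The truncation is zero at `T` itself, so independence gives no information there; one point is
  -- negligible.
  have hne : ∀ᵐ t ∂lebesgue, t ≠ T := by
    simpa [ae_iff] using lebesgue_singleton T
  filter_upwards [key e, hne] with t ht htT hle
  rwa [killAt_of_lt _ (lt_of_le_of_ne hle htT)] at ht

end

section

variable {H : Type*} [NormedAddCommGroup H] [InnerProductSpace ℂ H] [CompleteSpace H]
  [TopologicalSpace.SeparableSpace H] {S : Frame H} {I : Type*}

/-! ## Calculus of differentials -/

theorem differential_eta (Z : Option I → S.W) : differential (Z none) (fun a => Z (some a)) = Z := by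
  funext e
  cases e <;> rfl

theorem isAdapted_differential {A : S.W} {B : I → S.W} (hA : IsAdapted A)
    (hB : ∀ a, IsAdapted (B a)) (e : Option I) : IsAdapted (differential A B e) := by
  cases e
  · exact hA
  · exact hB _

variable [Fintype I]

theorem Direction.conj_sign (d : Direction) : (starRingEnd ℂ) d.sign = d.sign := by
  cases d <;> simp [Direction.sign]

theorem Direction.sign_smul_sign_smul (d : Direction) (X : S.W) : d.sign • d.sign • X = X := by
  have h : d.sign * d.sign = 1 := by cases d <;> simp [Direction.sign]
  rw [smul_smul, h, one_smul]

namespace Noise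

variable (N : Noise S I)

/-- A left inverse of a self-map of a finite set is also a right inverse. -/
theorem star_j (b : I) : N.star (N.j b) = b := by
  have hinj : Function.Injective N.star := Function.LeftInverse.injective N.j_star
  obtain ⟨a, rfl⟩ := Finite.injective_iff_surjective.1 hinj b
  rw [N.j_star]

/-- Since `star` is a bijection with inverse `j`, the sum over the fibre of `b` reduces to the
single term `j b`. -/
theorem star'_eq (X : Expr S I) : N.star' X = (adj X.1, differential (adj (X.2 none))
    fun b => N.ρ b (adj (X.2 (some (N.j b))))) := by
  classical
  unfold star'
  congr 2
  funext b
  refine (Finset.sum_eq_single_of_mem (N.j b) (by simp [N.star_j]) fun a ha hab => ?_).trans rfl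
  obtain rfl := (Finset.mem_filter.1 ha).2
  exact absurd (N.j_star a).symm hab

theorem transport_smul_one (e : Option I) (c : ℂ) : N.transport e (c • (1 : S.W)) = c • 1 := by
  cases e
  · rfl
  · simp [transport]

theorem transport_zero (e : Option I) : N.transport e (0 : S.W) = 0 := by
  cases e
  · rfl
  · simp [transport]

theorem itoProduct_zero_left (Z : Option I → S.W) : N.itoProduct 0 Z = 0 := by
  funext e
  simp [itoProduct]

theorem itoProduct_zero_right (Z : Option I → S.W) : N.itoProduct Z 0 = 0 := by
  funext e
  simp [itoProduct]

theorem itoProduct_add_left (Z Z' Y : Option I → S.W) :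
    N.itoProduct (Z + Z') Y = N.itoProduct Z Y + N.itoProduct Z' Y := by
  funext e
  simp [itoProduct, mul_add, add_mul, Finset.sum_add_distrib]

theorem itoProduct_smul_left (c : ℂ) (Z Y : Option I → S.W) :
    N.itoProduct (c • Z) Y = c • N.itoProduct Z Y := by
  funext e
  simp [itoProduct, Finset.smul_sum]

theorem diff_mul (Z : Option I → S.W) (Y : Expr S I) :
    N.mul (diff Z) Y = diff ((fun e => Z e * Y.1) + N.itoProduct Z Y.2) := by
  simp only [mul, diff, zero_mul]
  refine Prod.ext rfl (funext fun e => ?_)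
  simp [transport_zero]

theorem proc_mul (P : S.W) (Y : Expr S I) :
    N.mul (proc P) Y = (P * Y.1, fun e => N.transport e P * Y.2 e) := by
  refine Prod.ext rfl (funext fun e => ?_)
  simp [mul, proc, itoProduct_zero_left]

/-- The bilinear Itô product of three differentials, as a sum over the Itô table. -/
theorem itoProduct_itoProduct (X Y Z : Option I → S.W) (e : Option I) :
    N.itoProduct (N.itoProduct X Y) Z e = ∑ a, ∑ b, ∑ γ, ∑ ε,
      N.c ε γ e * (N.ρ γ (N.c a b (some ε)) *
        (N.ρ γ (N.ρ b (X (some a)) * Y (some b)) * Z (some γ))) := by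
  -- Only the components `some ε` of the inner product meet the third factor, so its `dτ` part
  -- disappears. What remains is to move the sum over `ε` inside the others.
  simp only [itoProduct, map_sum, map_mul, Finset.sum_mul, Finset.mul_sum, mul_assoc]
  calc _ = ∑ ε, ∑ a, ∑ γ, ∑ b, _ := Finset.sum_congr rfl fun ε _ => Finset.sum_comm
    _ = ∑ a, ∑ ε, ∑ γ, ∑ b, _ := Finset.sum_comm
    _ = ∑ a, ∑ ε, ∑ b, ∑ γ, _ := Finset.sum_congr rfl fun a _ =>
        Finset.sum_congr rfl fun ε _ => Finset.sum_comm
    _ = ∑ a, ∑ b, ∑ ε, ∑ γ, _ := Finset.sum_congr rfl fun a _ => Finset.sum_comm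
    _ = _ := Finset.sum_congr rfl fun a _ => Finset.sum_congr rfl fun b _ => Finset.sum_comm

theorem isAdapted_itoProduct {Z Z' : Option I → S.W} (hZ : ∀ a, IsAdapted (Z a))
    (hZ' : ∀ a, IsAdapted (Z' a)) (e : Option I) : IsAdapted (N.itoProduct Z Z' e) :=
  isAdapted_sum fun a _ => isAdapted_sum fun b _ =>
    -- The time `0` is arbitrary: only the adaptedness contained in integrability is used.
    (N.c_integrable a b e 0).1.mul ((N.ρ_adapted b _ (hZ _)).mul (hZ' _))

theorem isAdapted_transport {P : S.W} (hP : IsAdapted P) (e : Option I) :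
    IsAdapted (N.transport e P) := by
  cases e
  · exact hP
  · exact N.ρ_adapted _ _ hP

end Noise

/-! ## The Riccati equations in terms of coefficients -/

namespace ControlData

variable {T : ℝ≥0} (K : ControlData S I T) (N : Noise S I) (d : Direction)

theorem κ_eq : K.κ N = fun a => N.ρ a (adj K.w) * N.ρ a (adj (K.Fa (N.j a))) :=
  funext fun _ => map_mul _ _ _

theorem star'_Nw : N.star' K.Nw = diff (differential 0 (K.κ N)) := by
  rw [N.star'_eq]
  simp [Nw, dM, diff, differential, adj_zero, adj_mul, κ_eq]

theorem star'_Nw_add : N.star' (K.Nw + d.sign • proc 1) =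
    (d.sign • 1, differential 0 (K.κ N)) := by
  rw [N.star'_eq]
  simp [Nw, dM, diff, proc, differential, adj_zero, adj_mul, adj_smul, adj_one, κ_eq,
    d.conj_sign]

/-- The scalar `±1` passes through each `ρ_a` unchanged, so the factor `(Nw ± id)*` contributes `±Z`
plus an Itô product. -/
theorem star'_Nw_add_mul_diff (Z : Option I → S.W) :
    N.mul (N.star' (K.Nw + d.sign • proc 1)) (diff Z) =
      diff (d.sign • Z + N.itoProduct (differential 0 (K.κ N)) Z) := by
  rw [star'_Nw_add]
  refine Prod.ext (by simp [Noise.mul, diff]) (funext fun e => ?_)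
  simp [Noise.mul, diff, N.transport_smul_one]

/-- In `±(Nw ± id)* dΠ (Nw ± id)`, the terms with one factor `Nw` or `Nw*` carry two signs, which
cancel. The term `dΠ` carries three and the triple product one, so both keep `±`. -/
theorem riccati_snd (P : S.W) (Z : Option I → S.W) (e : Option I) :
    (K.riccati N d P Z).2 e =
      differential (adj K.F * P + P * K.F + K.Q - P * K.G * K.Rinv * adj K.G * P) 0 e
      + differential 0 (K.κ N) e * P
      + N.transport e P * differential 0 (fun a => K.Fa a * K.w) e
      + d.sign • N.itoProduct (fun e => differential 0 (K.κ N) e * P)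
          (differential 0 fun a => K.Fa a * K.w) e
      + d.sign • Z e
      + N.itoProduct (differential 0 (K.κ N)) Z e
      + N.itoProduct Z (differential 0 fun a => K.Fa a * K.w) e
      + d.sign • N.itoProduct (N.itoProduct (differential 0 (K.κ N)) Z)
          (differential 0 fun a => K.Fa a * K.w) e := by
  simp only [riccati, star'_Nw_add_mul_diff, star'_Nw, N.diff_mul, N.proc_mul]
  simp only [dtau, diff, proc, Nw, dM, N.itoProduct_zero_right, N.itoProduct_add_left,
    N.itoProduct_smul_left, Prod.snd_add, Prod.fst_add, Prod.smul_snd, Prod.smul_fst,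
    Pi.add_apply, Pi.smul_apply, add_zero, smul_zero, zero_add, mul_zero, mul_one, mul_smul_comm,
    smul_add, d.sign_smul_sign_smul, ← Pi.zero_def]
  abel

theorem affine_snd (P : S.W) (Z : Option I → S.W) (r : S.W) (Y : Option I → S.W) (e : Option I) :
    (K.affine N d P Z r Y).2 e =
      differential (adj K.F * r - P * K.G * K.Rinv * adj K.G * r + P * K.L + adj K.m
        - P * K.G * K.Rinv * adj K.η) 0 e
      + differential 0 (K.κ N) e * r
      + N.transport e P * differential 0 (fun a => K.Fa a * K.z) e
      + N.itoProduct Z (differential 0 fun a => K.Fa a * K.z) e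
      + d.sign • N.itoProduct (fun e => differential 0 (K.κ N) e * P)
          (differential 0 fun a => K.Fa a * K.z) e
      + d.sign • N.itoProduct (N.itoProduct (differential 0 (K.κ N)) Z)
          (differential 0 fun a => K.Fa a * K.z) e
      + (d.sign • Y e + N.itoProduct (differential 0 (K.κ N)) Y e) := by
  simp only [affine, star'_Nw_add_mul_diff, star'_Nw, N.diff_mul, N.proc_mul]
  simp only [dtau, diff, proc, Nz, dM, N.itoProduct_zero_right, Prod.snd_add, Prod.smul_snd,
    Pi.add_apply, Pi.smul_apply, add_zero, zero_add, mul_zero, ← Pi.zero_def]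

theorem riccati_snd_none (P A : S.W) (B : I → S.W) :
    (K.riccati N d P (differential A B)).2 none = K.riccatiEq₀ N d P A B := by
  rw [riccati_snd, N.itoProduct_itoProduct]
  simp only [Noise.itoProduct, differential, Option.elim, riccatiEq₀, Finset.sum_add_distrib,
    ← Finset.smul_sum, mul_assoc, zero_mul, mul_zero, add_zero]
  abel

theorem riccati_snd_some (P A : S.W) (B : I → S.W) (J : I) :
    (K.riccati N d P (differential A B)).2 (some J) = K.riccatiEq N d P B J := by
  rw [riccati_snd, N.itoProduct_itoProduct]
  simp only [Noise.itoProduct, differential, Option.elim, riccatiEq, Finset.sum_add_distrib,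
    ← Finset.smul_sum, mul_assoc, Pi.zero_apply, zero_add, Noise.transport]
  abel

theorem affine_snd_none (P A : S.W) (B : I → S.W) (r C : S.W) (D : I → S.W) :
    (K.affine N d P (differential A B) r (differential C D)).2 none =
      K.affineEq₀ N d P B r C D := by
  rw [affine_snd, N.itoProduct_itoProduct]
  simp only [Noise.itoProduct, differential, Option.elim, affineEq₀, Finset.sum_add_distrib,
    ← Finset.smul_sum, mul_assoc, zero_mul, mul_zero, add_zero]
  abel

theorem affine_snd_some (P A : S.W) (B : I → S.W) (r C : S.W) (D : I → S.W) (J : I) :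
    (K.affine N d P (differential A B) r (differential C D)).2 (some J) =
      K.affineEq N d P B r D J := by
  rw [affine_snd, N.itoProduct_itoProduct]
  simp only [Noise.itoProduct, differential, Option.elim, affineEq, Finset.sum_add_distrib,
    ← Finset.smul_sum, mul_assoc, Pi.zero_apply, zero_add, Noise.transport]
  abel

/-! ## Adaptedness of the coefficients -/

theorem isAdapted_κ (a : I) : IsAdapted (K.κ N a) :=
  N.ρ_adapted _ _ (K.coeff_w.1.adj.mul (K.coeff_Fa _).1.adj)

/-- In deducing the differential equation from the operator equations, integrability of the
collected coefficients comes from their vanishing almost everywhere. Adaptedness is the part that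
has to be checked separately. -/
theorem isAdapted_riccati_snd {P : S.W} {Z : Option I → S.W} (hP : IsAdapted P)
    (hZ : ∀ e, IsAdapted (Z e)) (e : Option I) : IsAdapted ((K.riccati N d P Z).2 e) := by
  have hκ := isAdapted_differential (isAdapted_zero (S := S)) (K.isAdapted_κ N)
  have hw := isAdapted_differential (isAdapted_zero (S := S))
    fun a => (K.coeff_Fa a).1.mul K.coeff_w.1
  have hF := K.coeff_F.1
  have hG := K.coeff_G.1
  have hQ := K.weight_Q.1.1
  have hR := K.weight_Rinv.1.1
  rw [riccati_snd]
  have h0 := (((hF.adj.mul hP).add (hP.mul hF)).add hQ).sub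
    ((((hP.mul hG).mul hR).mul hG.adj).mul hP)
  exact (((((((isAdapted_differential (B := 0) h0 (fun _ => isAdapted_zero) e).add
    ((hκ e).mul hP)).add
    ((N.isAdapted_transport hP e).mul (hw e))).add
    ((N.isAdapted_itoProduct (fun e => (hκ e).mul hP) hw e).smul _)).add
    ((hZ e).smul _)).add
    (N.isAdapted_itoProduct hκ hZ e)).add
    (N.isAdapted_itoProduct hZ hw e)).add
    ((N.isAdapted_itoProduct (N.isAdapted_itoProduct hκ hZ) hw e).smul _)

theorem isAdapted_affine_snd {P r : S.W} {Z Y : Option I → S.W} (hP : IsAdapted P)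
    (hZ : ∀ e, IsAdapted (Z e)) (hr : IsAdapted r) (hY : ∀ e, IsAdapted (Y e)) (e : Option I) :
    IsAdapted ((K.affine N d P Z r Y).2 e) := by
  have hκ := isAdapted_differential (isAdapted_zero (S := S)) (K.isAdapted_κ N)
  have hz := isAdapted_differential (isAdapted_zero (S := S))
    fun a => (K.coeff_Fa a).1.mul K.coeff_z.1
  have hG := K.coeff_G.1
  have hPGR := (hP.mul hG).mul K.weight_Rinv.1.1
  rw [affine_snd]
  have h0 := ((((K.coeff_F.1.adj.mul hr).sub ((hPGR.mul hG.adj).mul hr)).add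
    (hP.mul K.coeff_L.1)).add K.weight_m.1.1.adj).sub (hPGR.mul K.weight_η.1.1.adj)
  exact ((((((isAdapted_differential (B := 0) h0 (fun _ => isAdapted_zero) e).add
    ((hκ e).mul hr)).add
    ((N.isAdapted_transport hP e).mul (hz e))).add
    (N.isAdapted_itoProduct hZ hz e)).add
    ((N.isAdapted_itoProduct (fun e => (hκ e).mul hP) hz e).smul _)).add
    ((N.isAdapted_itoProduct (N.isAdapted_itoProduct hκ hZ) hz e).smul _)).add
    (((hY e).smul _).add (N.isAdapted_itoProduct hκ hY e))

/-! ## The differential equations and the operator equations -/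

theorem riccati_vanishes_iff (hT : 0 < T) (hN : LinearlyIndependent N.M) {P : S.W}
    (hP : IsAdapted P) {A : S.W} {B : I → S.W}
    (hAB : N.HasDifferential T P (differential A B)) :
    N.DifferentialVanishes T (K.riccati N d P (differential A B)).2 ↔
      VanishesOn T (K.riccatiEq₀ N d P A B) ∧ ∀ J, VanishesOn T (K.riccatiEq N d P B J) := by
  rw [N.differentialVanishes_iff hN hT
    (K.isAdapted_riccati_snd N d hP fun e => (hAB.1 e).1), Option.forall]
  simp only [riccati_snd_none, riccati_snd_some]

theorem affine_vanishes_iff (hT : 0 < T) (hN : LinearlyIndependent N.M) {P : S.W}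
    (hP : IsAdapted P) {A : S.W} {B : I → S.W} (hAB : N.HasDifferential T P (differential A B))
    {r : S.W} (hr : IsAdapted r) {C : S.W} {D : I → S.W}
    (hCD : N.HasDifferential T r (differential C D)) :
    N.DifferentialVanishes T (K.affine N d P (differential A B) r (differential C D)).2 ↔
      VanishesOn T (K.affineEq₀ N d P B r C D) ∧ ∀ J, VanishesOn T (K.affineEq N d P B r D J) := by
  rw [N.differentialVanishes_iff hN hT
    (K.isAdapted_affine_snd N d hP (fun e => (hAB.1 e).1) hr fun e => (hCD.1 e).1),
    Option.forall]
  simp only [affine_snd_none, affine_snd_some]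

end ControlData

end

end AFQ

theorem proposition1 {H : Type*} [NormedAddCommGroup H] [InnerProductSpace ℂ H] [CompleteSpace H]
    [TopologicalSpace.SeparableSpace H] {S : AFQ.Frame H} {I : Type*} [Fintype I]
    (N : AFQ.Noise S I) {T : ℝ≥0} (hT : 0 < T) (K : AFQ.ControlData S I T) (d : AFQ.Direction)
    (hN : AFQ.LinearlyIndependent N.M)
    (P : S.W) (hP : AFQ.IsCoefficient P) (hPsa : AFQ.adj P = P) :
    (K.SolvesRiccati N d P ↔
      ∃ (A : S.W) (B : I → S.W), N.HasDifferential T P (AFQ.differential A B) ∧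
        (∀ ξ : S.D, (P.1 (d.boundaryTime T) ξ : H) = K.Qb ξ) ∧
        AFQ.VanishesOn T (K.riccatiEq₀ N d P A B) ∧
        ∀ J, AFQ.VanishesOn T (K.riccatiEq N d P B J)) ∧
    (∀ (A : S.W) (B : I → S.W), N.HasDifferential T P (AFQ.differential A B) →
      (N.DifferentialVanishes T (K.riccati N d P (AFQ.differential A B)).2 ↔
        AFQ.VanishesOn T (K.riccatiEq₀ N d P A B) ∧
        ∀ J, AFQ.VanishesOn T (K.riccatiEq N d P B J))) ∧
    (∀ (A : S.W) (B : I → S.W), N.HasDifferential T P (AFQ.differential A B) →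
      ∀ r : S.W, AFQ.IsCoefficient r →
        (K.SolvesAffine N d P (AFQ.differential A B) r ↔
          ∃ (C : S.W) (D : I → S.W), N.HasDifferential T r (AFQ.differential C D) ∧
            (∀ ξ : S.D, (r.1 (d.boundaryTime T) ξ : H) =
              ContinuousLinearMap.adjoint K.mb (ξ : H)) ∧
            AFQ.VanishesOn T (K.affineEq₀ N d P B r C D) ∧
            ∀ J, AFQ.VanishesOn T (K.affineEq N d P B r D J)) ∧
        ∀ (C : S.W) (D : I → S.W), N.HasDifferential T r (AFQ.differential C D) →
          (N.DifferentialVanishes T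
              (K.affine N d P (AFQ.differential A B) r (AFQ.differential C D)).2 ↔
            AFQ.VanishesOn T (K.affineEq₀ N d P B r C D) ∧
            ∀ J, AFQ.VanishesOn T (K.affineEq N d P B r D J))) := by
  refine ⟨⟨?_, ?_⟩, fun A B hAB => K.riccati_vanishes_iff N d hT hN hP.1 hAB,
    fun A B hAB r hr => ⟨⟨?_, ?_⟩, fun C D hCD => K.affine_vanishes_iff N d hT hN hP.1 hAB hr.1 hCD⟩⟩
  · rintro ⟨⟨Z, hZ, hv⟩, hb⟩
    -- An arbitrary coefficient family is split into its `dτ` part and its `dM_a` parts, which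
    -- supply `A` and `B`.
    rw [← AFQ.differential_eta Z] at hZ hv
    exact ⟨_, _, hZ, hb, (K.riccati_vanishes_iff N d hT hN hP.1 hZ).1 hv⟩
  · rintro ⟨A, B, hAB, hb, hv⟩
    exact ⟨⟨_, hAB, (K.riccati_vanishes_iff N d hT hN hP.1 hAB).2 hv⟩, hb⟩
  · rintro ⟨⟨Y, hY, hv⟩, hb⟩
    rw [← AFQ.differential_eta Y] at hY hv
    exact ⟨_, _, hY, hb, (K.affine_vanishes_iff N d hT hN hP.1 hAB hr.1 hY).1 hv⟩
  · rintro ⟨C, D, hCD, hb, hv⟩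
    exact ⟨⟨_, hCD, (K.affine_vanishes_iff N d hT hN hP.1 hAB hr.1 hCD).2 hv⟩, hb⟩
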